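/- For $r\in\mathbb{N}$, $r\ge 1$, and $F\subseteq[r]=\{1,\dots,r\}$ let $$\Delta_F=\{(x_1,\dots,x_r)\in\mathbb{R}^r : x_i\ge 0 \text{ for all } i,\ x_1+\cdots+x_r=1,\ x_i=0 \text{ for } i\notin F\}$$ (so $\Delta_\emptyset=\emptyset$). A face of a polytope $P$ is the set of points of $P$ at which some linear functional attains its maximum over $P$; the vertices and edges of $P$ are its faces of dimension $0$ and $1$, and the degree of a vertex is the number of edges containing it. The empty set has dimension $-1$. For a nonempty polytope $P$ let $\overline{\deg}(P)$ be the average of the degrees of the vertices of $P$. Let $r\ge 1$ and let $F,F'\subseteq[r]$ be such that the Minkowski sum $P=\Delta_F+\Delta_{F'}\subseteq\mathbb{R}^r$ has dimension $r-1$. Then $$r-1\le\overline{\deg}(P),\qquad\text{and, if } r\ge 2,\qquad \overline{\deg}(P)<\tfrac{10}{9}(r-1).$$ Moreover, $\overline{\deg}(P)=r-1$ if and only if (i) $F\subseteq F'$, or (ii) $F'\subseteq F$, or (iii) $|F\cap F'|=1$. Finally, $\overline{\deg}(P)/(r-1)$ can become arbitrarily close to $10/9$ for large $r$: for every $\varepsilon>0$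 there is $r_0$ such that for every $r\ge r_0$ there are $F,F'\subseteq[r]$ for which $P=\Delta_F+\Delta_{F'}$ has dimension $r-1$ and $\left|\overline{\deg}(P)/(r-1)-\tfrac{10}{9}\right|<\varepsilon$. -/

import Mathlib

open scoped Pointwise

/-- The face `Δ_F` of the standard simplex in `ℝ^r`: the points of the standard simplex whose
coordinates outside `F` vanish. It is empty when `F` is empty. -/
def simplexFace {r : ℕ} (F : Finset (Fin r)) : Set (Fin r → ℝ) :=
  {x | x ∈ stdSimplex ℝ (Fin r) ∧ ∀ i, i ∉ F → x i = 0}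

/-- The dimension of a subset of `ℝ^r`: the dimension of its affine hull, with the empty set
having dimension `-1`. -/
noncomputable def setDim {r : ℕ} (S : Set (Fin r → ℝ)) : ℤ :=
  open Classical in
  if S.Nonempty then (Module.finrank ℝ (vectorSpan ℝ S) : ℤ) else -1

/-- The vertices of `P`: the points that form a zero-dimensional face, that is, the points at
which some linear functional attains its maximum over `P` and attains it nowhere else. -/
def polyVertices {r : ℕ} (P : Set (Fin r → ℝ)) : Set (Fin r → ℝ) :=
  P.exposedPoints ℝ

/-- The edges of `P`: the one-dimensional faces, a face being the set of all points of `P` at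
which some linear functional attains its maximum over `P`. -/
def polyEdges {r : ℕ} (P : Set (Fin r → ℝ)) : Set (Set (Fin r → ℝ)) :=
  {Q | IsExposed ℝ P Q ∧ setDim Q = 1}

/-- The degree of `v` in `P`: the number of edges of `P` that contain `v`. -/
noncomputable def polyDegree {r : ℕ} (P : Set (Fin r → ℝ)) (v : Fin r → ℝ) : ℕ :=
  {Q | Q ∈ polyEdges P ∧ v ∈ Q}.ncard

/-- The average of the degrees of the vertices of `P`. -/
noncomputable def averageDegree {r : ℕ} (P : Set (Fin r → ℝ)) : ℝ :=
  (∑ᶠ v ∈ polyVertices P, (polyDegree P v : ℝ)) / ((polyVertices P).ncard : ℝ)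

/-! The polytope is reduced to counting. A linear functional is a weight `w` on indices, and the
face it cuts out of a Minkowski sum is the sum of the faces it cuts out of the summands. So every
nonempty face is `Δ_G + Δ_H`, with `G` and `H` the maximizers of `w` on `F` and `F'`; the pairs that
occur are characterized combinatorially by `IsFacePair`, and a face determines its pair
(`IsFacePair.eq_of_add_eq`).

Full dimension means that `F` and `F'` meet and cover all indices. A vertex is `e_i + e_j` where `i`
and `j` do not both lie in `F ∩ F'` unless they are equal. Listing the edges at it
(`filter_edgePairs_eq`) gives degree `r - 1`, except when `i ∈ F \ F'` and `j ∈ F' \ F`, where there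
are `|F ∩ F'| - 1` additional edges (`polyDegree_add_one`).

With `a = |F \ F'|`, `b = |F' \ F|`, `c = |F ∩ F'| - 1`, the average is therefore `a + b + c + abc /
V`, where `V = ab + bc + ca + a + b + c + 1` is the number of vertices (`averageDegree_eq`). The
lower bound is immediate, with equality exactly when `abc = 0`; the upper bound follows from `9abc ≤
(a + b + c)(ab + bc + ca)`; and nearly equal `a`, `b`, `c` make `10/9` the limit. -/

/-! ### Simplex faces and the dimension of their sums -/

theorem single_mem_simplexFace {r : ℕ} {F : Finset (Fin r)} {i : Fin r} (hi : i ∈ F) :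
    (Pi.single i 1 : Fin r → ℝ) ∈ simplexFace F := by
  refine ⟨single_mem_stdSimplex ℝ i, fun j hj => ?_⟩
  rw [Pi.single_eq_of_ne]
  rintro rfl
  exact hj hi

theorem simplexFace_nonempty_iff {r : ℕ} {F : Finset (Fin r)} :
    (simplexFace F).Nonempty ↔ F.Nonempty := by
  constructor
  · rintro ⟨x, ⟨_, hx⟩, h0⟩
    by_contra hF
    rw [Finset.not_nonempty_iff_eq_empty] at hF
    subst hF
    simp [h0] at hx
  · rintro ⟨i, hi⟩
    exact ⟨_, single_mem_simplexFace hi⟩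

theorem simplexFace_eq_convexHull {r : ℕ} (F : Finset (Fin r)) :
    simplexFace F = convexHull ℝ ((fun i => (Pi.single i 1 : Fin r → ℝ)) '' (F : Set (Fin r))) := by
  apply Set.Subset.antisymm
  · rintro x ⟨⟨hx0, hx1⟩, hx⟩
    have hsum : ∑ i ∈ F, x i = 1 := by
      rw [← hx1]
      exact Finset.sum_subset (Finset.subset_univ _) fun i _ hi => hx i hi
    have hxe : x = ∑ i ∈ F, x i • (Pi.single i 1 : Fin r → ℝ) := by
      rw [Finset.sum_subset (Finset.subset_univ F)
        fun i _ hi => by rw [hx i hi, zero_smul]]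
      exact pi_eq_sum_univ' x |>.trans (by
        refine Finset.sum_congr rfl fun i _ => ?_
        congr 1)
    rw [hxe]
    exact (convex_convexHull ℝ _).sum_mem (fun i _ => hx0 i) hsum
      fun i hi => subset_convexHull ℝ _ ⟨i, hi, rfl⟩
  · apply convexHull_min
    · rintro _ ⟨i, hi, rfl⟩
      exact single_mem_simplexFace hi
    · intro x hx y hy a b ha hb hab
      refine ⟨convex_stdSimplex ℝ _ hx.1 hy.1 ha hb hab, fun i hi => ?_⟩
      simp [hx.2 i hi, hy.2 i hi]

theorem vectorSpan_add {E : Type*} [AddCommGroup E] [Module ℝ E] {A B : Set E}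
    (hA : A.Nonempty) (hB : B.Nonempty) :
    vectorSpan ℝ (A + B) = vectorSpan ℝ A ⊔ vectorSpan ℝ B := by
  obtain ⟨a, ha⟩ := hA
  obtain ⟨b, hb⟩ := hB
  apply le_antisymm
  · rw [vectorSpan_def, Submodule.span_le]
    rintro _ ⟨_, ⟨x, hx, y, hy, rfl⟩, _, ⟨x', hx', y', hy', rfl⟩, rfl⟩
    have : (x + y) -ᵥ (x' + y') = (x -ᵥ x') + (y -ᵥ y') := by
      simp only [vsub_eq_sub]; abel
    simp only [SetLike.mem_coe]
    rw [this]
    exact Submodule.add_mem_sup (vsub_mem_vectorSpan ℝ hx hx') (vsub_mem_vectorSpan ℝ hy hy')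
  · apply sup_le
    · rw [vectorSpan_def, Submodule.span_le]
      rintro _ ⟨x, hx, x', hx', rfl⟩
      have := vsub_mem_vectorSpan ℝ (Set.add_mem_add hx hb) (Set.add_mem_add hx' hb)
      simpa using this
    · rw [vectorSpan_def, Submodule.span_le]
      rintro _ ⟨x, hx, x', hx', rfl⟩
      have := vsub_mem_vectorSpan ℝ (Set.add_mem_add ha hx) (Set.add_mem_add ha hx')
      simpa using this

theorem vectorSpan_simplexFace {r : ℕ} (F : Finset (Fin r)) :
    vectorSpan ℝ (simplexFace F) =
      vectorSpan ℝ ((fun i => (Pi.single i 1 : Fin r → ℝ)) '' (F : Set (Fin r))) := by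
  rw [simplexFace_eq_convexHull, ← direction_affineSpan, affineSpan_convexHull,
    direction_affineSpan]

theorem affineIndependent_single (r : ℕ) :
    AffineIndependent ℝ (fun i : Fin r => (Pi.single i 1 : Fin r → ℝ)) := by
  have := (Pi.basisFun ℝ (Fin r)).linearIndependent.affineIndependent
  rwa [show ⇑(Pi.basisFun ℝ (Fin r)) = fun i => Pi.single i 1 from
    funext (Pi.basisFun_apply ℝ (Fin r))] at this

theorem finrank_vectorSpan_simplexFace {r : ℕ} {F : Finset (Fin r)} (hF : F.Nonempty) :
    Module.finrank ℝ (vectorSpan ℝ (simplexFace F)) + 1 = F.card := by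
  rw [vectorSpan_simplexFace]
  have hc : F.card = (F.card - 1) + 1 := by have := hF.card_pos; omega
  have h := (affineIndependent_single r).finrank_vectorSpan_image_finset (s := F) hc
  rw [Finset.coe_image] at h
  omega

theorem mem_vectorSpan_simplexFace_apply {r : ℕ} {F : Finset (Fin r)} {x : Fin r → ℝ}
    (hx : x ∈ vectorSpan ℝ (simplexFace F)) {i : Fin r} (hi : i ∉ F) : x i = 0 := by
  rw [vectorSpan_def] at hx
  induction hx using Submodule.span_induction with
  | mem x h =>
    obtain ⟨y, hy, z, hz, rfl⟩ := h
    simp [hy.2 i hi, hz.2 i hi]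
  | zero => rfl
  | add x y _ _ hx hy => simp [hx, hy]
  | smul a x _ hx => simp [hx]

theorem setDim_add_of_inter_nonempty {r : ℕ} {G H : Finset (Fin r)} (h : (G ∩ H).Nonempty) :
    setDim (simplexFace G + simplexFace H) = ((G ∪ H).card : ℤ) - 1 := by
  obtain ⟨k, hk⟩ := h
  rw [Finset.mem_inter] at hk
  have hG : G.Nonempty := ⟨k, hk.1⟩
  have hH : H.Nonempty := ⟨k, hk.2⟩
  rw [setDim, if_pos ((simplexFace_nonempty_iff.2 hG).add (simplexFace_nonempty_iff.2 hH)),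
    vectorSpan_add (simplexFace_nonempty_iff.2 hG) (simplexFace_nonempty_iff.2 hH)]
  have hU : (G ∪ H).Nonempty := ⟨k, by simp [hk.1]⟩
  have : vectorSpan ℝ (simplexFace G) ⊔ vectorSpan ℝ (simplexFace H) =
      vectorSpan ℝ (simplexFace (G ∪ H)) := by
    simp only [vectorSpan_simplexFace]
    -- With the common index `k` as base point, each direction space is spanned by the differences
    -- `e_i - e_k`, and these spanning sets unite.
    have hspan : ∀ K : Finset (Fin r), k ∈ K → _ := fun K hK =>
      vectorSpan_eq_span_vsub_set_right ℝ
        (Set.mem_image_of_mem (fun i => (Pi.single i 1 : Fin r → ℝ)) (Finset.mem_coe.2 hK))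
    rw [hspan G hk.1, hspan H hk.2, hspan (G ∪ H) (Finset.mem_union_left H hk.1),
      ← Submodule.span_union, ← Set.image_union, ← Set.image_union, Finset.coe_union]
  rw [this, ← finrank_vectorSpan_simplexFace hU]
  push_cast
  ring

theorem setDim_add_of_disjoint {r : ℕ} {G H : Finset (Fin r)} (hG : G.Nonempty) (hH : H.Nonempty)
    (h : G ∩ H = ∅) :
    setDim (simplexFace G + simplexFace H) = (G.card : ℤ) + H.card - 2 := by
  rw [setDim, if_pos ((simplexFace_nonempty_iff.2 hG).add (simplexFace_nonempty_iff.2 hH)),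
    vectorSpan_add (simplexFace_nonempty_iff.2 hG) (simplexFace_nonempty_iff.2 hH)]
  have hinf : vectorSpan ℝ (simplexFace G) ⊓ vectorSpan ℝ (simplexFace H) = ⊥ := by
    rw [eq_bot_iff]
    rintro x ⟨hx, hx'⟩
    rw [Submodule.mem_bot]
    ext i
    by_cases hi : i ∈ G
    · refine mem_vectorSpan_simplexFace_apply hx' fun hi' => ?_
      have := Finset.mem_inter.2 ⟨hi, hi'⟩
      simp [h] at this
    · exact mem_vectorSpan_simplexFace_apply hx hi
  have := Submodule.finrank_sup_add_finrank_inf_eq (vectorSpan ℝ (simplexFace G))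
    (vectorSpan ℝ (simplexFace H))
  rw [hinf, finrank_bot] at this
  have h1 := finrank_vectorSpan_simplexFace hG
  have h2 := finrank_vectorSpan_simplexFace hH
  omega

/-- Disjoint nonempty sets have independent direction spaces, so their sum has dimension at most `r
- 2`; sets that meet behave like their union. -/
theorem setDim_add_eq_sub_one_iff {r : ℕ} (hr : 1 ≤ r) {F H : Finset (Fin r)} :
    setDim (simplexFace F + simplexFace H) = (r : ℤ) - 1 ↔
      (F ∩ H).Nonempty ∧ F ∪ H = Finset.univ := by
  have hcard : F ∪ H = Finset.univ ↔ (F ∪ H).card = r := by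
    rw [← Finset.card_eq_iff_eq_univ, Fintype.card_fin]
  rw [hcard]
  by_cases h : (F ∩ H).Nonempty
  · rw [setDim_add_of_inter_nonempty h]
    simp only [h, true_and]
    omega
  · simp only [h, false_and, iff_false]
    rw [Finset.not_nonempty_iff_eq_empty] at h
    by_cases hF : F.Nonempty
    · by_cases hH : H.Nonempty
      · rw [setDim_add_of_disjoint hF hH h]
        have h1 := Finset.card_union_add_card_inter F H
        have h2 := Finset.card_le_univ (F ∪ H)
        rw [h, Finset.card_empty] at h1
        rw [Fintype.card_fin] at h2
        omega
      · rw [setDim, if_neg]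
        · omega
        · rw [Set.add_nonempty, simplexFace_nonempty_iff, simplexFace_nonempty_iff]
          tauto
    · rw [setDim, if_neg]
      · omega
      · rw [Set.add_nonempty, simplexFace_nonempty_iff, simplexFace_nonempty_iff]
        tauto

/-! ### Faces of the sum as pairs of index sets -/

theorem toExposed_add {E : Type*} [TopologicalSpace E] [AddCommGroup E] [Module ℝ E]
    (l : E →L[ℝ] ℝ) {A B : Set E} :
    l.toExposed (A + B) = l.toExposed A + l.toExposed B := by
  ext x
  constructor
  · rintro ⟨⟨a, ha, b, hb, rfl⟩, h⟩
    refine ⟨a, ⟨ha, fun y hy => ?_⟩, b, ⟨hb, fun y hy => ?_⟩, rfl⟩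
    · have := h _ (Set.add_mem_add hy hb)
      simp only [map_add] at this
      linarith
    · have := h _ (Set.add_mem_add ha hy)
      simp only [map_add] at this
      linarith
  · rintro ⟨a, ⟨ha, ha'⟩, b, ⟨hb, hb'⟩, rfl⟩
    refine ⟨⟨a, ha, b, hb, rfl⟩, ?_⟩
    rintro _ ⟨y, hy, z, hz, rfl⟩
    simp only [map_add]
    exact add_le_add (ha' y hy) (hb' z hz)

open Classical in
/-- The elements of `F` at which `w` attains its maximum over `F`. -/
noncomputable def maximizers {r : ℕ} (w : Fin r → ℝ) (F : Finset (Fin r)) : Finset (Fin r) :=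
  F.filter fun i => ∀ j ∈ F, w j ≤ w i

theorem mem_maximizers {r : ℕ} {w : Fin r → ℝ} {F : Finset (Fin r)} {i : Fin r} :
    i ∈ maximizers w F ↔ i ∈ F ∧ ∀ j ∈ F, w j ≤ w i := by
  simp [maximizers]

theorem maximizers_nonempty {r : ℕ} {w : Fin r → ℝ} {F : Finset (Fin r)} (hF : F.Nonempty) :
    (maximizers w F).Nonempty := by
  obtain ⟨i, hi, h⟩ := F.exists_max_image w hF
  exact ⟨i, mem_maximizers.2 ⟨hi, h⟩⟩

theorem clm_apply_eq_sum {r : ℕ} (l : (Fin r → ℝ) →L[ℝ] ℝ) (x : Fin r → ℝ) :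
    l x = ∑ i, x i * l (Pi.single i 1) := by
  conv_lhs => rw [← Finset.univ_sum_single x]
  rw [map_sum]
  refine Finset.sum_congr rfl fun i _ => ?_
  rw [← smul_eq_mul, ← map_smul, ← Pi.single_smul', smul_eq_mul, mul_one]

theorem toExposed_simplexFace {r : ℕ} (l : (Fin r → ℝ) →L[ℝ] ℝ) {F : Finset (Fin r)}
    (hF : F.Nonempty) :
    l.toExposed (simplexFace F) = simplexFace (maximizers (fun i => l (Pi.single i 1)) F) := by
  obtain ⟨m, hm⟩ := maximizers_nonempty (w := fun i => l (Pi.single i 1)) hF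
  rw [mem_maximizers] at hm
  have hle : ∀ x ∈ simplexFace F, ∀ i, x i * l (Pi.single i 1) ≤ x i * l (Pi.single m 1) := by
    intro x hx i
    by_cases hi : i ∈ F
    · exact mul_le_mul_of_nonneg_left (hm.2 i hi) (hx.1.1 i)
    · simp [hx.2 i hi]
  have hsum : ∀ x ∈ simplexFace F, ∑ i, x i * l (Pi.single m 1) = l (Pi.single m 1) := by
    intro x hx
    rw [← Finset.sum_mul, hx.1.2, one_mul]
  ext x
  constructor
  · rintro ⟨hx, h⟩
    refine ⟨hx.1, fun i hi => ?_⟩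
    by_cases hiF : i ∈ F
    swap
    · exact hx.2 i hiF
    have h1 := h _ (single_mem_simplexFace hm.1)
    rw [clm_apply_eq_sum l x] at h1
    -- Termwise inequalities with equal sums are termwise equalities, so `x` vanishes wherever the
    -- weight is not maximal.
    have h2 : ∑ i, x i * l (Pi.single i 1) = ∑ i, x i * l (Pi.single m 1) :=
      le_antisymm (Finset.sum_le_sum fun i _ => hle x hx i) (by rw [hsum x hx]; exact h1)
    rw [Finset.sum_eq_sum_iff_of_le fun i _ => hle x hx i] at h2
    rcases mul_eq_mul_left_iff.1 (h2 i (Finset.mem_univ _)) with h3 | h3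
    · refine absurd (mem_maximizers.2 ⟨hiF, fun j hj => ?_⟩) hi
      rw [h3]
      exact hm.2 j hj
    · exact h3
  · intro hx
    have hxF : x ∈ simplexFace F :=
      ⟨hx.1, fun i hi => hx.2 i fun h => hi (mem_maximizers.1 h).1⟩
    refine ⟨hxF, fun y hy => ?_⟩
    have hx' : l x = l (Pi.single m 1) := by
      rw [clm_apply_eq_sum l x, ← hsum x hxF]
      refine Finset.sum_congr rfl fun i _ => ?_
      by_cases hi : i ∈ maximizers (fun i => l (Pi.single i 1)) F
      · rw [mem_maximizers] at hi
        rw [le_antisymm (hm.2 i hi.1) (hi.2 m hm.1)]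
      · simp [hx.2 i hi]
    rw [hx', clm_apply_eq_sum l y, ← hsum y hy]
    exact Finset.sum_le_sum fun i _ => hle y hy i

/-- The pairs `(G, H)` for which `Δ_G + Δ_H` is a face of `Δ_F + Δ_F'`. -/
structure IsFacePair {r : ℕ} (F F' G H : Finset (Fin r)) : Prop where
  left_nonempty : G.Nonempty
  right_nonempty : H.Nonempty
  left_subset : G ⊆ F
  right_subset : H ⊆ F'
  compatible : G ∩ F' = ∅ ∨ H ∩ F = ∅ ∨ G ∩ F' = H ∩ F

theorem exists_clm_single {r : ℕ} (w : Fin r → ℝ) :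
    ∃ l : (Fin r → ℝ) →L[ℝ] ℝ, (fun i => l (Pi.single i 1)) = w := by
  refine ⟨LinearMap.toContinuousLinearMap (∑ i, w i • LinearMap.proj i), ?_⟩
  ext i
  simp [Pi.single_apply]

/-- Compare the maxima of `w` on `F` and on `F'`: maximizers for the larger one cannot lie in the
other set, and if the maxima agree, both maximizer sets have the same trace on `F ∩ F'`. -/
theorem isFacePair_maximizers {r : ℕ} {F F' : Finset (Fin r)} (hF : F.Nonempty)
    (hF' : F'.Nonempty) (w : Fin r → ℝ) :
    IsFacePair F F' (maximizers w F) (maximizers w F') := by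
  refine ⟨maximizers_nonempty hF, maximizers_nonempty hF', fun i hi => (mem_maximizers.1 hi).1,
    fun i hi => (mem_maximizers.1 hi).1, ?_⟩
  obtain ⟨m, hm⟩ := maximizers_nonempty (w := w) hF
  obtain ⟨m', hm'⟩ := maximizers_nonempty (w := w) hF'
  rw [mem_maximizers] at hm hm'
  rcases lt_trichotomy (w m) (w m') with h | h | h
  · refine Or.inr (Or.inl (Finset.eq_empty_of_forall_notMem fun i hi => ?_))
    rw [Finset.mem_inter, mem_maximizers] at hi
    have := hi.1.2 m' hm'.1
    have := hm.2 i hi.2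
    linarith
  · refine Or.inr (Or.inr ?_)
    ext i
    simp only [Finset.mem_inter, mem_maximizers]
    constructor
    · rintro ⟨⟨h1, h2⟩, h3⟩
      exact ⟨⟨h3, fun j hj => (hm'.2 j hj).trans (h ▸ h2 m hm.1)⟩, h1⟩
    · rintro ⟨⟨h1, h2⟩, h3⟩
      exact ⟨⟨h3, fun j hj => (hm.2 j hj).trans (h ▸ h2 m' hm'.1)⟩, h1⟩
  · refine Or.inl (Finset.eq_empty_of_forall_notMem fun i hi => ?_)
    rw [Finset.mem_inter, mem_maximizers] at hi
    have := hi.1.2 m hm.1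
    have := hm'.2 i hi.2
    linarith

theorem maximizers_eq {r : ℕ} {w : Fin r → ℝ} {F G : Finset (Fin r)} (hG : G.Nonempty)
    (hGF : G ⊆ F) (c : ℝ) (h1 : ∀ i ∈ G, w i = c) (h2 : ∀ i ∈ F, i ∉ G → w i < c) :
    maximizers w F = G := by
  ext i
  rw [mem_maximizers]
  constructor
  · rintro ⟨hi, h⟩
    by_contra hiG
    obtain ⟨g, hg⟩ := hG
    have := h g (hGF hg)
    have := h1 g hg
    have := h2 i hi hiG
    linarith
  · intro hi
    refine ⟨hGF hi, fun j hj => ?_⟩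
    rw [h1 i hi]
    by_cases hjG : j ∈ G
    · exact (h1 j hjG).le
    · exact (h2 j hj hjG).le

/-- Three weight levels suffice: the set that misses the other summand gets 2, the other gets 1, all
else 0. When the traces on `F ∩ F'` agree, the indicator of `G ∪ H` works. -/
theorem IsFacePair.exists_maximizers {r : ℕ} {F F' G H : Finset (Fin r)}
    (h : IsFacePair F F' G H) :
    ∃ w : Fin r → ℝ, maximizers w F = G ∧ maximizers w F' = H := by
  rcases h.compatible with hc | hc | hc
  · have hc' : ∀ i ∈ F', i ∉ G := fun i hi hi' => by
      have := Finset.mem_inter.2 ⟨hi', hi⟩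
      simp [hc] at this
    refine ⟨fun i => if i ∈ G then 2 else if i ∈ H then 1 else 0,
      maximizers_eq h.left_nonempty h.left_subset 2 ?_ ?_,
      maximizers_eq h.right_nonempty h.right_subset 1 ?_ ?_⟩
    · intro i hi
      simp [hi]
    · intro i _ hi
      simp only [hi, if_false]
      split_ifs <;> norm_num
    · intro i hi
      simp [hi, hc' i (h.right_subset hi)]
    · intro i hi hi'
      simp [hi', hc' i hi]
  · have hc' : ∀ i ∈ F, i ∉ H := fun i hi hi' => by
      have := Finset.mem_inter.2 ⟨hi', hi⟩
      simp [hc] at this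
    refine ⟨fun i => if i ∈ H then 2 else if i ∈ G then 1 else 0,
      maximizers_eq h.left_nonempty h.left_subset 1 ?_ ?_,
      maximizers_eq h.right_nonempty h.right_subset 2 ?_ ?_⟩
    · intro i hi
      simp [hi, hc' i (h.left_subset hi)]
    · intro i hi hi'
      simp [hi', hc' i hi]
    · intro i hi
      simp [hi]
    · intro i _ hi
      simp only [hi, if_false]
      split_ifs <;> norm_num
  · simp only [Finset.ext_iff, Finset.mem_inter] at hc
    have hl := h.left_subset
    have hr := h.right_subset
    refine ⟨fun i => if i ∈ G ∪ H then 1 else 0,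
      maximizers_eq h.left_nonempty h.left_subset 1 ?_ ?_,
      maximizers_eq h.right_nonempty h.right_subset 1 ?_ ?_⟩
    · intro i hi
      simp [hi]
    · intro i hi hi'
      have : i ∉ H := fun hH => hi' ((hc i).2 ⟨hH, hi⟩).1
      simp [hi', this]
    · intro i hi
      simp [hi]
    · intro i hi hi'
      have : i ∉ G := fun hG => hi' ((hc i).1 ⟨hG, hi⟩).1
      simp [hi', this]

/-- Nonemptiness of `Q` matters: `IsExposed` holds vacuously for the empty set. -/
theorem isExposed_add_simplexFace_iff {r : ℕ} {F F' : Finset (Fin r)} (hF : F.Nonempty)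
    (hF' : F'.Nonempty) {Q : Set (Fin r → ℝ)} (hQ : Q.Nonempty) :
    IsExposed ℝ (simplexFace F + simplexFace F') Q ↔
      ∃ G H, IsFacePair F F' G H ∧ Q = simplexFace G + simplexFace H := by
  constructor
  · intro h
    obtain ⟨l, hl⟩ := h hQ
    refine ⟨_, _, isFacePair_maximizers hF hF' fun i => l (Pi.single i 1), ?_⟩
    rw [← toExposed_simplexFace l hF, ← toExposed_simplexFace l hF', ← toExposed_add]
    exact hl
  · rintro ⟨G, H, h, rfl⟩ _
    obtain ⟨w, hw1, hw2⟩ := h.exists_maximizers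
    obtain ⟨l, rfl⟩ := exists_clm_single w
    refine ⟨l, ?_⟩
    rw [← hw1, ← hw2, ← toExposed_simplexFace l hF, ← toExposed_simplexFace l hF',
      ← toExposed_add]
    rfl

/-- If the sum maximizes a functional, exchanging one summand at a time shows that each summand does
too. This is what lets `G` and `H` be recovered from the face. -/
theorem IsFacePair.single_add_single_mem_iff {r : ℕ} {F F' G H : Finset (Fin r)}
    (h : IsFacePair F F' G H) {i j : Fin r} (hi : i ∈ F) (hj : j ∈ F') :
    (Pi.single i 1 + Pi.single j 1 : Fin r → ℝ) ∈ simplexFace G + simplexFace H ↔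
      i ∈ G ∧ j ∈ H := by
  constructor
  · intro hmem
    have hF : F.Nonempty := ⟨i, hi⟩
    have hF' : F'.Nonempty := ⟨j, hj⟩
    obtain ⟨w, rfl, rfl⟩ := h.exists_maximizers
    obtain ⟨l, rfl⟩ := exists_clm_single w
    rw [← toExposed_simplexFace l hF, ← toExposed_simplexFace l hF', ← toExposed_add] at hmem
    simp only [mem_maximizers]
    refine ⟨⟨hi, fun k hk => ?_⟩, hj, fun k hk => ?_⟩
    · have := hmem.2 _ (Set.add_mem_add (single_mem_simplexFace hk) (single_mem_simplexFace hj))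
      simp only [map_add] at this
      linarith
    · have := hmem.2 _ (Set.add_mem_add (single_mem_simplexFace hi) (single_mem_simplexFace hk))
      simp only [map_add] at this
      linarith
  · rintro ⟨h1, h2⟩
    exact Set.add_mem_add (single_mem_simplexFace h1) (single_mem_simplexFace h2)

theorem IsFacePair.eq_of_add_eq {r : ℕ} {F F' G H G' H' : Finset (Fin r)}
    (h : IsFacePair F F' G H) (h' : IsFacePair F F' G' H')
    (heq : simplexFace G + simplexFace H = simplexFace G' + simplexFace H') :
    G = G' ∧ H = H' := by
  have key : ∀ i ∈ F, ∀ j ∈ F', (i ∈ G ∧ j ∈ H ↔ i ∈ G' ∧ j ∈ H') := by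
    intro i hi j hj
    rw [← h.single_add_single_mem_iff hi hj, heq, h'.single_add_single_mem_iff hi hj]
  obtain ⟨g, hg⟩ := h.left_nonempty
  obtain ⟨k, hk⟩ := h.right_nonempty
  have hgk := (key g (h.left_subset hg) k (h.right_subset hk)).1 ⟨hg, hk⟩
  constructor
  · ext i
    constructor
    · exact fun hi => ((key i (h.left_subset hi) k (h.right_subset hk)).1 ⟨hi, hk⟩).1
    · exact fun hi => ((key i (h'.left_subset hi) k (h.right_subset hk)).2 ⟨hi, hgk.2⟩).1
  · ext j
    constructor
    · exact fun hj => ((key g (h.left_subset hg) j (h.right_subset hj)).1 ⟨hg, hj⟩).2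
    · exact fun hj => ((key g (h.left_subset hg) j (h'.right_subset hj)).2 ⟨hgk.1, hj⟩).2

/-! ### Edges at a vertex and vertex degrees -/

theorem isFacePair_singleton_iff {r : ℕ} {F F' : Finset (Fin r)} {i j : Fin r} :
    IsFacePair F F' {i} {j} ↔ i ∈ F ∧ j ∈ F' ∧ (i ∉ F' ∨ j ∉ F ∨ i = j) := by
  constructor
  · intro h
    have hi : i ∈ F := h.left_subset (Finset.mem_singleton_self i)
    have hj : j ∈ F' := h.right_subset (Finset.mem_singleton_self j)
    refine ⟨hi, hj, ?_⟩
    have hc := h.compatible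
    simp only [Finset.ext_iff, Finset.mem_inter, Finset.mem_singleton, Finset.notMem_empty] at hc
    grind
  · rintro ⟨hi, hj, h⟩
    refine ⟨by simp, by simp, by simpa using hi, by simpa using hj, ?_⟩
    simp only [Finset.ext_iff, Finset.mem_inter, Finset.mem_singleton, Finset.notMem_empty]
    grind

theorem isFacePair_pair_left_iff {r : ℕ} {F F' : Finset (Fin r)} {i j k : Fin r}
    (h : IsFacePair F F' {i} {j}) :
    IsFacePair F F' {i, k} {j} ↔ k ∈ F ∧ (j ∉ F ∨ k ∉ F' ∨ k = j) := by
  rw [isFacePair_singleton_iff] at h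
  constructor
  · intro hp
    have hkF : k ∈ F := hp.left_subset (by simp)
    have hc := hp.compatible
    simp only [Finset.ext_iff, Finset.mem_inter, Finset.mem_insert, Finset.mem_singleton,
      Finset.notMem_empty] at hc
    grind
  · rintro ⟨hkF, hc⟩
    refine ⟨by simp, by simp, ?_, by simpa using h.2.1, ?_⟩
    · simp [Finset.insert_subset_iff, h.1, hkF]
    · simp only [Finset.ext_iff, Finset.mem_inter, Finset.mem_insert, Finset.mem_singleton,
        Finset.notMem_empty]
      grind

theorem IsFacePair.symm {r : ℕ} {F F' G H : Finset (Fin r)} (h : IsFacePair F F' G H) :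
    IsFacePair F' F H G :=
  ⟨h.right_nonempty, h.left_nonempty, h.right_subset, h.left_subset, by
    rcases h.compatible with h | h | h
    · exact Or.inr (Or.inl h)
    · exact Or.inl h
    · exact Or.inr (Or.inr h.symm)⟩

theorem isFacePair_pair_right_iff {r : ℕ} {F F' : Finset (Fin r)} {i j k : Fin r}
    (h : IsFacePair F F' {i} {j}) :
    IsFacePair F F' {i} {j, k} ↔ k ∈ F' ∧ (i ∉ F' ∨ k ∉ F ∨ k = i) := by
  rw [← isFacePair_pair_left_iff h.symm]
  exact ⟨IsFacePair.symm, IsFacePair.symm⟩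

theorem isFacePair_pair_pair_iff {r : ℕ} {F F' : Finset (Fin r)} {i k : Fin r}
    (h : IsFacePair F F' {i} {i}) :
    IsFacePair F F' {i, k} {i, k} ↔ k ∈ F ∧ k ∈ F' := by
  rw [isFacePair_singleton_iff] at h
  constructor
  · intro hp
    exact ⟨hp.left_subset (by simp), hp.right_subset (by simp)⟩
  · rintro ⟨hk, hk'⟩
    refine ⟨by simp, by simp, ?_, ?_, Or.inr (Or.inr ?_)⟩
    · simp [Finset.insert_subset_iff, h.1, hk]
    · simp [Finset.insert_subset_iff, h.2.1, hk']
    · ext x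
      simp only [Finset.mem_inter, Finset.mem_insert, Finset.mem_singleton]
      grind

theorem exists_eq_pair_of_card_eq_two {α : Type*} [DecidableEq α] {G : Finset α} {i : α}
    (hi : i ∈ G) (h : G.card = 2) : ∃ k, k ≠ i ∧ G = {i, k} := by
  obtain ⟨x, y, hxy, rfl⟩ := Finset.card_eq_two.1 h
  rcases Finset.mem_insert.1 hi with rfl | hi
  · exact ⟨y, hxy.symm, rfl⟩
  · rw [Finset.mem_singleton] at hi
    subst hi
    exact ⟨x, hxy, Finset.pair_comm _ _⟩

theorem eq_singleton_of_card_eq_one {α : Type*} {G : Finset α} {i : α}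
    (hi : i ∈ G) (h : G.card = 1) : G = {i} := by
  obtain ⟨x, rfl⟩ := Finset.card_eq_one.1 h
  rw [Finset.mem_singleton.1 hi]

theorem setDim_pair_left {r : ℕ} {i j k : Fin r} (hk : k ≠ i) :
    setDim (simplexFace {i, k} + simplexFace {j}) = 1 := by
  by_cases hj : j ∈ ({i, k} : Finset (Fin r))
  · have hinter : ({i, k} ∩ {j} : Finset (Fin r)).Nonempty := ⟨j, by simpa using hj⟩
    rw [setDim_add_of_inter_nonempty hinter,
      Finset.union_eq_left.2 (by simpa using hj), Finset.card_pair hk.symm]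
    norm_num
  · rw [setDim_add_of_disjoint (by simp) (by simp) (Finset.inter_singleton_of_notMem hj),
      Finset.card_pair hk.symm]
    norm_num

/-- The dimension formulas leave three kinds of edge at `e_i + e_j`: move `i`, move `j`, or, when `i
= j`, move both together. -/
theorem setDim_eq_one_iff {r : ℕ} {F F' G H : Finset (Fin r)} {i j : Fin r}
    (h : IsFacePair F F' {i} {j}) (hp : IsFacePair F F' G H) (hi : i ∈ G) (hj : j ∈ H) :
    setDim (simplexFace G + simplexFace H) = 1 ↔
      (∃ k, k ≠ i ∧ G = {i, k} ∧ H = {j}) ∨ (∃ k, k ≠ j ∧ G = {i} ∧ H = {j, k}) ∨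
        (i = j ∧ ∃ k, k ≠ i ∧ G = {i, k} ∧ H = {i, k}) := by
  constructor
  · intro hd
    have hG := hp.left_nonempty.card_pos
    have hH := hp.right_nonempty.card_pos
    by_cases hinter : (G ∩ H).Nonempty
    · rw [setDim_add_of_inter_nonempty hinter] at hd
      have hGU := Finset.card_le_card (Finset.subset_union_left (s₁ := G) (s₂ := H))
      have hHU := Finset.card_le_card (Finset.subset_union_right (s₁ := G) (s₂ := H))
      have hsum := Finset.card_union_add_card_inter G H
      have hIpos := hinter.card_pos
      have hU : (G ∪ H).card = 2 := by omega
      by_cases hG1 : G.card = 1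
      · obtain ⟨k, hk, rfl⟩ := exists_eq_pair_of_card_eq_two hj (by omega)
        exact Or.inr (Or.inl ⟨k, hk, eq_singleton_of_card_eq_one hi hG1, rfl⟩)
      · by_cases hH1 : H.card = 1
        · obtain ⟨k, hk, rfl⟩ := exists_eq_pair_of_card_eq_two hi (by omega)
          exact Or.inl ⟨k, hk, rfl, eq_singleton_of_card_eq_one hj hH1⟩
        · have hGH : G = H := by
            rw [Finset.eq_of_subset_of_card_le (Finset.subset_union_left (s₁ := G) (s₂ := H))
              (by omega)]
            exact (Finset.eq_of_subset_of_card_le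
              (Finset.subset_union_right (s₁ := G) (s₂ := H)) (by omega)).symm
          subst hGH
          -- Here `i` and `j` both lie in `F ∩ F'`, where a vertex must have equal indices.
          have hij : i = j := by
            rcases (isFacePair_singleton_iff.1 h).2.2 with h1 | h1 | h1
            · exact absurd (hp.right_subset hi) h1
            · exact absurd (hp.left_subset hj) h1
            · exact h1
          obtain ⟨k, hk, rfl⟩ := exists_eq_pair_of_card_eq_two hi (by omega)
          exact Or.inr (Or.inr ⟨hij, k, hk, rfl, rfl⟩)
    · rw [setDim_add_of_disjoint hp.left_nonempty hp.right_nonempty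
        (Finset.not_nonempty_iff_eq_empty.1 hinter)] at hd
      by_cases hG1 : G.card = 1
      · obtain ⟨k, hk, rfl⟩ := exists_eq_pair_of_card_eq_two hj (by omega)
        exact Or.inr (Or.inl ⟨k, hk, eq_singleton_of_card_eq_one hi hG1, rfl⟩)
      · obtain ⟨k, hk, rfl⟩ := exists_eq_pair_of_card_eq_two hi (by omega)
        exact Or.inl ⟨k, hk, rfl, eq_singleton_of_card_eq_one hj (by omega)⟩
  · rintro (⟨k, hk, rfl, rfl⟩ | ⟨k, hk, rfl, rfl⟩ | ⟨rfl, k, hk, rfl, rfl⟩)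
    · exact setDim_pair_left hk
    · rw [add_comm]
      exact setDim_pair_left hk
    · rw [setDim_add_of_inter_nonempty ⟨i, by simp⟩, Finset.union_self, Finset.card_pair hk.symm]
      norm_num

open Classical in
/-- The pairs `(G, H)` for which `Δ_G + Δ_H` is an edge of `Δ_F + Δ_F'`. -/
noncomputable def edgePairs {r : ℕ} (F F' : Finset (Fin r)) :
    Finset (Finset (Fin r) × Finset (Fin r)) :=
  Finset.univ.filter fun p =>
    IsFacePair F F' p.1 p.2 ∧ setDim (simplexFace p.1 + simplexFace p.2) = 1

theorem mem_edgePairs {r : ℕ} {F F' : Finset (Fin r)} {p : Finset (Fin r) × Finset (Fin r)} :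
    p ∈ edgePairs F F' ↔
      IsFacePair F F' p.1 p.2 ∧ setDim (simplexFace p.1 + simplexFace p.2) = 1 := by
  simp [edgePairs]

theorem nonempty_of_setDim_eq_one {r : ℕ} {S : Set (Fin r → ℝ)} (h : setDim S = 1) :
    S.Nonempty := by
  by_contra hS
  rw [setDim, if_neg hS] at h
  norm_num at h

theorem polyEdges_eq_image {r : ℕ} {F F' : Finset (Fin r)} (hF : F.Nonempty)
    (hF' : F'.Nonempty) :
    polyEdges (simplexFace F + simplexFace F') =
      (fun p : Finset (Fin r) × Finset (Fin r) => simplexFace p.1 + simplexFace p.2) ''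
        (edgePairs F F' : Set (Finset (Fin r) × Finset (Fin r))) := by
  ext Q
  simp only [polyEdges, Set.mem_ofPred_eq, Set.mem_image, Finset.mem_coe, mem_edgePairs]
  constructor
  · rintro ⟨hQ, hd⟩
    obtain ⟨G, H, h, rfl⟩ :=
      (isExposed_add_simplexFace_iff hF hF' (nonempty_of_setDim_eq_one hd)).1 hQ
    exact ⟨(G, H), ⟨h, hd⟩, rfl⟩
  · rintro ⟨⟨G, H⟩, ⟨h, hd⟩, rfl⟩
    exact ⟨(isExposed_add_simplexFace_iff hF hF' (nonempty_of_setDim_eq_one hd)).2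
      ⟨G, H, h, rfl⟩, hd⟩

theorem polyDegree_eq_card {r : ℕ} {F F' : Finset (Fin r)} {i j : Fin r}
    (hi : i ∈ F) (hj : j ∈ F') :
    polyDegree (simplexFace F + simplexFace F') (Pi.single i 1 + Pi.single j 1) =
      ((edgePairs F F').filter fun p => i ∈ p.1 ∧ j ∈ p.2).card := by
  rw [polyDegree, polyEdges_eq_image ⟨i, hi⟩ ⟨j, hj⟩, ← Set.ncard_coe_finset]
  have : {Q | Q ∈ (fun p : Finset (Fin r) × Finset (Fin r) => simplexFace p.1 + simplexFace p.2) ''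
        (edgePairs F F' : Set (Finset (Fin r) × Finset (Fin r))) ∧
        (Pi.single i 1 + Pi.single j 1 : Fin r → ℝ) ∈ Q} =
      (fun p : Finset (Fin r) × Finset (Fin r) => simplexFace p.1 + simplexFace p.2) ''
        ((edgePairs F F').filter fun p => i ∈ p.1 ∧ j ∈ p.2 : Finset _) := by
    ext Q
    simp only [Set.mem_ofPred_eq, Set.mem_image, Finset.mem_coe, Finset.mem_filter]
    constructor
    · rintro ⟨⟨p, hp, rfl⟩, hQ⟩
      exact ⟨p, ⟨hp, ((mem_edgePairs.1 hp).1.single_add_single_mem_iff hi hj).1 hQ⟩, rfl⟩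
    · rintro ⟨p, ⟨hp, hQ⟩, rfl⟩
      exact ⟨⟨p, hp, rfl⟩, ((mem_edgePairs.1 hp).1.single_add_single_mem_iff hi hj).2 hQ⟩
  rw [this, Set.InjOn.ncard_image]
  intro p hp q hq hpq
  simp only [Finset.mem_coe, Finset.mem_filter, mem_edgePairs] at hp hq
  obtain ⟨h1, h2⟩ := hp.1.1.eq_of_add_eq hq.1.1 hpq
  exact Prod.ext h1 h2

theorem pair_right_injOn {α : Type*} [DecidableEq α] {i k k' : α} (hk : k ≠ i)
    (h : ({i, k} : Finset α) = {i, k'}) : k = k' := by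
  have : k ∈ ({i, k'} : Finset α) := h ▸ (by simp)
  simpa [hk] using this

theorem filter_edgePairs_eq {r : ℕ} {F F' : Finset (Fin r)} {i j : Fin r}
    (h : IsFacePair F F' {i} {j}) :
    ((edgePairs F F').filter fun p => i ∈ p.1 ∧ j ∈ p.2) =
      ((F.erase i).filter fun k => j ∉ F ∨ k ∉ F' ∨ k = j).image (fun k => ({i, k}, {j})) ∪
      (((F'.erase j).filter fun k => i ∉ F' ∨ k ∉ F ∨ k = i).image (fun k => ({i}, {j, k})) ∪
      (((F ∩ F').erase i).filter fun _ => i = j).image (fun k => ({i, k}, {i, k}))) := by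
  ext ⟨G, H⟩
  simp only [Finset.mem_filter, mem_edgePairs, Finset.mem_union, Finset.mem_image,
    Finset.mem_erase, Finset.mem_inter, Prod.mk.injEq]
  constructor
  · rintro ⟨⟨hp, hd⟩, hi, hj⟩
    rcases (setDim_eq_one_iff h hp hi hj).1 hd with
      ⟨k, hk, rfl, rfl⟩ | ⟨k, hk, rfl, rfl⟩ | ⟨rfl, k, hk, rfl, rfl⟩
    · have := (isFacePair_pair_left_iff h).1 hp
      exact Or.inl ⟨k, ⟨⟨hk, this.1⟩, this.2⟩, rfl, rfl⟩
    · have := (isFacePair_pair_right_iff h).1 hp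
      exact Or.inr (Or.inl ⟨k, ⟨⟨hk, this.1⟩, this.2⟩, rfl, rfl⟩)
    · have := (isFacePair_pair_pair_iff h).1 hp
      exact Or.inr (Or.inr ⟨k, ⟨⟨hk, this⟩, rfl⟩, rfl, rfl⟩)
  · rintro (⟨k, ⟨⟨hk, hkF⟩, hc⟩, rfl, rfl⟩ | ⟨k, ⟨⟨hk, hkF⟩, hc⟩, rfl, rfl⟩ |
      ⟨k, ⟨⟨hk, hkF⟩, rfl⟩, rfl, rfl⟩)
    · have hp := (isFacePair_pair_left_iff h).2 ⟨hkF, hc⟩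
      exact ⟨⟨hp, (setDim_eq_one_iff h hp (by simp) (by simp)).2
        (Or.inl ⟨k, hk, rfl, rfl⟩)⟩, by simp, by simp⟩
    · have hp := (isFacePair_pair_right_iff h).2 ⟨hkF, hc⟩
      exact ⟨⟨hp, (setDim_eq_one_iff h hp (by simp) (by simp)).2
        (Or.inr (Or.inl ⟨k, hk, rfl, rfl⟩))⟩, by simp, by simp⟩
    · have hp := (isFacePair_pair_pair_iff h).2 hkF
      exact ⟨⟨hp, (setDim_eq_one_iff h hp (by simp) (by simp)).2
        (Or.inr (Or.inr ⟨rfl, k, hk, rfl, rfl⟩))⟩, by simp, by simp⟩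

theorem card_filter_edgePairs {r : ℕ} {F F' : Finset (Fin r)} {i j : Fin r}
    (h : IsFacePair F F' {i} {j}) :
    ((edgePairs F F').filter fun p => i ∈ p.1 ∧ j ∈ p.2).card =
      ((F.erase i).filter fun k => j ∉ F ∨ k ∉ F' ∨ k = j).card +
      (((F'.erase j).filter fun k => i ∉ F' ∨ k ∉ F ∨ k = i).card +
      (((F ∩ F').erase i).filter fun _ => i = j).card) := by
  have hne : ∀ {x k : Fin r}, k ≠ x → ∀ y, ({x, k} : Finset (Fin r)) ≠ {y} := by
    intro x k hk y hxy
    have := congrArg Finset.card hxy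
    rw [Finset.card_pair hk.symm, Finset.card_singleton] at this
    omega
  rw [filter_edgePairs_eq h, Finset.card_union_of_disjoint, Finset.card_union_of_disjoint,
    Finset.card_image_of_injOn, Finset.card_image_of_injOn, Finset.card_image_of_injOn]
  · intro k hk k' _ hkk'
    simp only [Finset.mem_coe, Finset.mem_filter, Finset.mem_erase] at hk
    exact pair_right_injOn hk.1.1 (Prod.mk.inj hkk').1
  · intro k hk k' _ hkk'
    simp only [Finset.mem_coe, Finset.mem_filter, Finset.mem_erase] at hk
    exact pair_right_injOn hk.1.1 (Prod.mk.inj hkk').2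
  · intro k hk k' _ hkk'
    simp only [Finset.mem_coe, Finset.mem_filter, Finset.mem_erase] at hk
    exact pair_right_injOn hk.1.1 (Prod.mk.inj hkk').1
  · rw [Finset.disjoint_left]
    rintro _ h1 h2
    obtain ⟨k, _, rfl⟩ := Finset.mem_image.1 h1
    obtain ⟨k', hk', he⟩ := Finset.mem_image.1 h2
    simp only [Finset.mem_filter, Finset.mem_erase] at hk'
    exact hne hk'.1.1 _ (Prod.mk.inj he).1
  · rw [Finset.disjoint_left]
    rintro _ h1 h2
    obtain ⟨k, hk, rfl⟩ := Finset.mem_image.1 h1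
    simp only [Finset.mem_filter, Finset.mem_erase] at hk
    rcases Finset.mem_union.1 h2 with h2 | h2
    · obtain ⟨k', _, he⟩ := Finset.mem_image.1 h2
      exact hne hk.1.1 _ (Prod.mk.inj he).1.symm
    · obtain ⟨k', hk', he⟩ := Finset.mem_image.1 h2
      simp only [Finset.mem_filter, Finset.mem_erase] at hk'
      exact hne hk'.1.1 _ (Prod.mk.inj he).2

/-- The count does not depend on `i`: if `j ∈ F` and `i ∉ F'`, the target `i` lost from `F \ F'` is
replaced by the new target `j`. -/
theorem card_filter_erase {r : ℕ} {F F' : Finset (Fin r)} {i j : Fin r}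
    (h : IsFacePair F F' {i} {j}) :
    ((F.erase i).filter fun k => j ∉ F ∨ k ∉ F' ∨ k = j).card =
      if j ∈ F then (F \ F').card else F.card - 1 := by
  obtain ⟨hi, hj, hij⟩ := isFacePair_singleton_iff.1 h
  split_ifs with hjF
  · by_cases hiF' : i ∈ F'
    · obtain rfl : i = j := by tauto
      congr 1
      ext k
      simp only [Finset.mem_filter, Finset.mem_erase, Finset.mem_sdiff]
      grind
    · have : ((F.erase i).filter fun k => j ∉ F ∨ k ∉ F' ∨ k = j) =
          insert j ((F \ F').erase i) := by
        ext k
        simp only [Finset.mem_filter, Finset.mem_erase, Finset.mem_sdiff, Finset.mem_insert]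
        grind
      have hiA : i ∈ F \ F' := Finset.mem_sdiff.2 ⟨hi, hiF'⟩
      rw [this, Finset.card_insert_of_notMem (by simp [hj]), Finset.card_erase_add_one hiA]
  · rw [Finset.filter_true_of_mem fun _ _ => Or.inl hjF, Finset.card_erase_of_mem hi]

theorem polyDegree_add_one {r : ℕ} {F F' : Finset (Fin r)} {i j : Fin r}
    (h : IsFacePair F F' {i} {j}) (hne : (F ∩ F').Nonempty) :
    polyDegree (simplexFace F + simplexFace F') (Pi.single i 1 + Pi.single j 1) + 1 =
      (F ∪ F').card + if i ∉ F' ∧ j ∉ F then (F ∩ F').card - 1 else 0 := by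
  obtain ⟨hi, hj, hij⟩ := isFacePair_singleton_iff.1 h
  rw [polyDegree_eq_card hi hj, card_filter_edgePairs h, card_filter_erase h,
    card_filter_erase h.symm]
  have h1 := Finset.card_sdiff_add_card_inter F F'
  have h2 := Finset.card_sdiff_add_card_inter F' F
  have h3 := Finset.card_union_add_card_inter F F'
  rw [Finset.inter_comm F' F] at h2
  have hZ : (((F ∩ F').erase i).filter fun _ => i = j).card =
      if i = j then (F ∩ F').card - 1 else 0 := by
    split_ifs with hh
    · subst hh
      rw [Finset.filter_true_of_mem fun _ _ => rfl,
        Finset.card_erase_of_mem (Finset.mem_inter.2 ⟨hi, hj⟩)]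
    · simp [hh]
  rw [hZ]
  have hFpos : 0 < F.card := Finset.card_pos.2 ⟨i, hi⟩
  have hFpos' : 0 < F'.card := Finset.card_pos.2 ⟨j, hj⟩
  by_cases hiF : i ∈ F'
  · by_cases hjF : j ∈ F
    · obtain rfl : i = j := by tauto
      have : 0 < (F ∩ F').card := Finset.card_pos.2 ⟨i, Finset.mem_inter.2 ⟨hi, hj⟩⟩
      simp only [hiF, hjF, if_true, not_true, false_and, if_false]
      omega
    · have hij' : i ≠ j := by rintro rfl; exact hjF hi
      simp only [hiF, hjF, hij', if_true, not_true, false_and, if_false]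
      omega
  · by_cases hjF : j ∈ F
    · have hij' : i ≠ j := by rintro rfl; exact hiF hj
      simp only [hiF, hjF, hij', if_true, not_true, and_false, if_false]
      omega
    · have hij' : i ≠ j := by rintro rfl; exact hiF hj
      simp only [hiF, hjF, hij', not_false_iff, and_true, if_true, if_false]
      have := hne.card_pos
      omega

/-! ### Vertices and the average degree -/

theorem simplexFace_singleton {r : ℕ} (i : Fin r) :
    simplexFace {i} = {(Pi.single i 1 : Fin r → ℝ)} := by
  rw [simplexFace_eq_convexHull, Finset.coe_singleton, Set.image_singleton, convexHull_singleton]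

open Classical in
/-- The pairs `(i, j)` for which `e_i + e_j` is a vertex of `Δ_F + Δ_F'`. -/
noncomputable def vertexPairs {r : ℕ} (F F' : Finset (Fin r)) : Finset (Fin r × Fin r) :=
  Finset.univ.filter fun p => IsFacePair F F' {p.1} {p.2}

theorem mem_vertexPairs {r : ℕ} {F F' : Finset (Fin r)} {p : Fin r × Fin r} :
    p ∈ vertexPairs F F' ↔ IsFacePair F F' {p.1} {p.2} := by
  simp [vertexPairs]

theorem single_one_injective (r : ℕ) :
    Function.Injective fun i : Fin r => (Pi.single i 1 : Fin r → ℝ) :=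
  (affineIndependent_single r).injective

theorem polyVertices_eq_image {r : ℕ} {F F' : Finset (Fin r)} (hF : F.Nonempty)
    (hF' : F'.Nonempty) :
    polyVertices (simplexFace F + simplexFace F') =
      (fun p : Fin r × Fin r => (Pi.single p.1 1 + Pi.single p.2 1 : Fin r → ℝ)) ''
        (vertexPairs F F' : Set (Fin r × Fin r)) := by
  ext x
  rw [polyVertices, mem_exposedPoints_iff_exposed_singleton,
    isExposed_add_simplexFace_iff hF hF' (Set.singleton_nonempty x)]
  simp only [Set.mem_image, Finset.mem_coe, mem_vertexPairs]
  constructor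
  · rintro ⟨G, H, h, hx⟩
    have heq : ∀ i ∈ G, ∀ j ∈ H, (Pi.single i 1 + Pi.single j 1 : Fin r → ℝ) = x := by
      intro i hi j hj
      have := Set.add_mem_add (single_mem_simplexFace hi) (single_mem_simplexFace hj)
      rwa [← hx] at this
    obtain ⟨i, hi⟩ := h.left_nonempty
    obtain ⟨j, hj⟩ := h.right_nonempty
    have hG : G = {i} := Finset.eq_singleton_iff_unique_mem.2 ⟨hi, fun k hk =>
      single_one_injective r (add_right_cancel ((heq k hk j hj).trans (heq i hi j hj).symm))⟩
    have hH : H = {j} := Finset.eq_singleton_iff_unique_mem.2 ⟨hj, fun k hk =>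
      single_one_injective r (add_left_cancel ((heq i hi k hk).trans (heq i hi j hj).symm))⟩
    exact ⟨(i, j), hG ▸ hH ▸ h, heq i hi j hj⟩
  · rintro ⟨⟨i, j⟩, h, rfl⟩
    exact ⟨_, _, h, by simp [simplexFace_singleton]⟩

theorem injOn_vertexPairs {r : ℕ} (F F' : Finset (Fin r)) :
    Set.InjOn (fun p : Fin r × Fin r => (Pi.single p.1 1 + Pi.single p.2 1 : Fin r → ℝ))
      (vertexPairs F F' : Set (Fin r × Fin r)) := by
  intro p hp q hq hpq
  rw [Finset.mem_coe, mem_vertexPairs] at hp hq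
  obtain ⟨h1, h2⟩ := hp.eq_of_add_eq hq (by
    simp only [simplexFace_singleton, Set.singleton_add_singleton]
    exact congrArg _ hpq)
  exact Prod.ext (Finset.singleton_injective h1) (Finset.singleton_injective h2)

theorem vertexPairs_eq {r : ℕ} (F F' : Finset (Fin r)) :
    vertexPairs F F' =
      (F \ F') ×ˢ F' ∪ ((F ∩ F') ×ˢ (F' \ F) ∪ (F ∩ F').diag) := by
  ext ⟨i, j⟩
  simp only [mem_vertexPairs, isFacePair_singleton_iff, Finset.mem_union, Finset.mem_product,
    Finset.mem_sdiff, Finset.mem_inter, Finset.mem_diag]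
  grind

theorem card_vertexPairs {r : ℕ} (F F' : Finset (Fin r)) :
    (vertexPairs F F').card = (F \ F').card * (F' \ F).card + (F \ F').card * (F ∩ F').card +
      (F' \ F).card * (F ∩ F').card + (F ∩ F').card := by
  have h2 := Finset.card_sdiff_add_card_inter F' F
  rw [Finset.inter_comm F' F] at h2
  rw [vertexPairs_eq, Finset.card_union_of_disjoint, Finset.card_union_of_disjoint,
    Finset.card_product, Finset.card_product, Finset.diag_card, ← h2]
  · ring
  · rw [Finset.disjoint_left]
    rintro ⟨i, j⟩
    simp only [Finset.mem_product, Finset.mem_sdiff, Finset.mem_inter, Finset.mem_diag]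
    grind
  · rw [Finset.disjoint_left]
    rintro ⟨i, j⟩
    simp only [Finset.mem_product, Finset.mem_sdiff, Finset.mem_inter, Finset.mem_diag,
      Finset.mem_union]
    grind

theorem filter_vertexPairs {r : ℕ} (F F' : Finset (Fin r)) :
    ((vertexPairs F F').filter fun p => p.1 ∉ F' ∧ p.2 ∉ F) = (F \ F') ×ˢ (F' \ F) := by
  ext ⟨i, j⟩
  simp only [Finset.mem_filter, mem_vertexPairs, isFacePair_singleton_iff, Finset.mem_product,
    Finset.mem_sdiff]
  grind

theorem averageDegree_eq {r : ℕ} {F F' : Finset (Fin r)} (hne : (F ∩ F').Nonempty)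
    {a b c : ℕ} (ha : (F \ F').card = a) (hb : (F' \ F).card = b) (hc : (F ∩ F').card = c + 1) :
    averageDegree (simplexFace F + simplexFace F') =
      (a + b + c : ℝ) + a * b * c / (a * b + a * (c + 1) + b * (c + 1) + (c + 1)) := by
  obtain ⟨k, hk⟩ := hne
  have hk' := Finset.mem_inter.1 hk
  have hU : (F ∪ F').card = a + b + c + 1 := by
    have h1 := Finset.card_sdiff_add_card_inter F F'
    have h2 := Finset.card_sdiff_add_card_inter F' F
    have h3 := Finset.card_union_add_card_inter F F'
    rw [Finset.inter_comm F' F] at h2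
    omega
  have hdeg : ∀ p ∈ vertexPairs F F',
      (polyDegree (simplexFace F + simplexFace F') (Pi.single p.1 1 + Pi.single p.2 1) : ℝ) =
        (a + b + c : ℝ) + if p.1 ∉ F' ∧ p.2 ∉ F then (c : ℝ) else 0 := by
    intro p hp
    have h := polyDegree_add_one (mem_vertexPairs.1 hp) ⟨k, hk⟩
    rw [hU, hc, Nat.add_sub_cancel] at h
    have h' := congrArg (Nat.cast : ℕ → ℝ) h
    push_cast at h'
    linarith
  have hV : ((vertexPairs F F').card : ℝ) =
      a * b + a * (c + 1) + b * (c + 1) + (c + 1) := by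
    rw [card_vertexPairs, ha, hb, hc]
    push_cast
    ring
  have hVne : (a * b + a * (c + 1) + b * (c + 1) + (c + 1) : ℝ) ≠ 0 := by positivity
  rw [averageDegree, polyVertices_eq_image ⟨k, hk'.1⟩ ⟨k, hk'.2⟩,
    finsum_mem_image (injOn_vertexPairs F F'), finsum_mem_coe_finset, Finset.sum_congr rfl hdeg,
    (injOn_vertexPairs F F').ncard_image, Set.ncard_coe_finset, Finset.sum_add_distrib,
    ← Finset.sum_filter, filter_vertexPairs, Finset.sum_const, Finset.sum_const,
    Finset.card_product, ha, hb, nsmul_eq_mul, nsmul_eq_mul, hV, add_div,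
    mul_div_cancel_left₀ _ hVne]
  push_cast
  rfl

/-! ### Estimates and the main theorem -/

theorem nine_mul_mul_lt {a b c : ℝ} (ha : 0 ≤ a) (hb : 0 ≤ b) (hc : 0 ≤ c)
    (h : 0 < a + b + c) :
    9 * (a * b * c) < (a + b + c) * (a * b + a * (c + 1) + b * (c + 1) + (c + 1)) := by
  -- The three squares sum to `(a + b + c)(ab + bc + ca) - 9abc`; strictness comes from the
  -- remaining terms, which form `h4`.
  have h1 : 0 ≤ a * (b - c) ^ 2 := by positivity
  have h2 : 0 ≤ b * (a - c) ^ 2 := by positivity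
  have h3 : 0 ≤ c * (a - b) ^ 2 := by positivity
  have h4 : 0 < (a + b + c) * (a + b + c + 1) := by positivity
  nlinarith

/-- This is the case `a = b = n`, `c = n + s`; the slack `s ≤ 2` is there to reach every residue of
`r - 1` modulo 3. -/
theorem average_ratio_close {n s : ℕ} (hn : 1 ≤ n) (hs : s ≤ 2) :
    |((n + n + (n + s : ℕ) : ℝ) + n * n * (n + s : ℕ) /
        (n * n + n * ((n + s : ℕ) + 1) + n * ((n + s : ℕ) + 1) + ((n + s : ℕ) + 1))) /
      (n + n + (n + s : ℕ)) - 10 / 9| ≤ 2 / n := by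
  have hn' : (1 : ℝ) ≤ n := by exact_mod_cast hn
  have hs' : (s : ℝ) ≤ 2 := by exact_mod_cast hs
  have hs0 : (0 : ℝ) ≤ s := Nat.cast_nonneg s
  push_cast
  generalize (n : ℝ) = x at *
  generalize (s : ℝ) = t at *
  have hV : 0 < x * x + x * (x + t + 1) + x * (x + t + 1) + (x + t + 1) := by positivity
  have hS : 0 < x + x + (x + t) := by positivity
  have heq : (x + x + (x + t) + x * x * (x + t) /
      (x * x + x * (x + t + 1) + x * (x + t + 1) + (x + t + 1))) / (x + x + (x + t)) - 10 / 9 =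
      -((9 * x ^ 2 + 6 * x * t + 3 * x + 2 * x * t ^ 2 + t ^ 2 + t) /
        (9 * ((x + x + (x + t)) *
          (x * x + x * (x + t + 1) + x * (x + t + 1) + (x + t + 1))))) := by
    field_simp
    ring
  have hx0 : 0 < x := by linarith
  -- Put `t = 2` and use `1 ≤ x`: `38 = 9 + 12 + 3 + 8 + 4 + 2`. With the denominator at least `81 *
  -- x ^ 3`, the error is at most `38 / (81 * x)`, below `2 / x`.
  have hnum : 9 * x ^ 2 + 6 * x * t + 3 * x + 2 * x * t ^ 2 + t ^ 2 + t ≤ 38 * x ^ 2 := by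
    have h1 : x * t ≤ x * 2 := mul_le_mul_of_nonneg_left hs' hx0.le
    have h2 : t ^ 2 ≤ 4 := by nlinarith
    have h3 : x * t ^ 2 ≤ x * 4 := mul_le_mul_of_nonneg_left h2 hx0.le
    nlinarith
  have hden : 27 * x ^ 3 ≤ 3 * ((x + x + (x + t)) *
      (x * x + x * (x + t + 1) + x * (x + t + 1) + (x + t + 1))) := by
    have h1 : 3 * x ≤ x + x + (x + t) := by linarith
    have h2 : 3 * x ^ 2 ≤ x * x + x * (x + t + 1) + x * (x + t + 1) + (x + t + 1) := by
      have : 0 ≤ x * t := by positivity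
      nlinarith
    have := mul_le_mul h1 h2 (by positivity) hS.le
    linarith
  rw [heq, abs_neg, abs_of_nonneg (by positivity), div_le_div_iff₀ (by positivity) hx0]
  have := mul_le_mul_of_nonneg_right hnum hx0.le
  have : 0 < x ^ 3 := by positivity
  linarith

theorem mainTheorem8 :
    (∀ r : ℕ, 1 ≤ r → ∀ F F' : Finset (Fin r),
      setDim (simplexFace F + simplexFace F') = (r : ℤ) - 1 →
        (r : ℝ) - 1 ≤ averageDegree (simplexFace F + simplexFace F') ∧
        (2 ≤ r → averageDegree (simplexFace F + simplexFace F') < 10 / 9 * ((r : ℝ) - 1)) ∧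
        (averageDegree (simplexFace F + simplexFace F') = (r : ℝ) - 1 ↔
          F ⊆ F' ∨ F' ⊆ F ∨ (F ∩ F').card = 1)) ∧
    (∀ ε : ℝ, 0 < ε → ∃ r₀ : ℕ, ∀ r : ℕ, r₀ ≤ r → ∃ F F' : Finset (Fin r),
      setDim (simplexFace F + simplexFace F') = (r : ℤ) - 1 ∧
        |averageDegree (simplexFace F + simplexFace F') / ((r : ℝ) - 1) - 10 / 9| < ε) := by
  constructor
  · intro r hr F F' hd
    obtain ⟨hne, hU⟩ := (setDim_add_eq_sub_one_iff hr).1 hd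
    obtain ⟨c, hc⟩ := Nat.exists_eq_add_of_lt hne.card_pos
    rw [zero_add] at hc
    rw [averageDegree_eq hne rfl rfl hc]
    have hr' : r = (F \ F').card + (F' \ F).card + c + 1 := by
      have h1 := Finset.card_sdiff_add_card_inter F F'
      have h2 := Finset.card_sdiff_add_card_inter F' F
      have h3 := Finset.card_union_add_card_inter F F'
      rw [hU, Finset.card_univ, Fintype.card_fin] at h3
      rw [Finset.inter_comm F' F] at h2
      omega
    have hrR : (r : ℝ) - 1 = (F \ F').card + (F' \ F).card + c := by
      have := congrArg (Nat.cast : ℕ → ℝ) hr'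
      push_cast at this
      linarith
    have hA : F ⊆ F' ↔ (F \ F').card = 0 := by
      rw [Finset.card_eq_zero, Finset.sdiff_eq_empty_iff_subset]
    have hB : F' ⊆ F ↔ (F' \ F).card = 0 := by
      rw [Finset.card_eq_zero, Finset.sdiff_eq_empty_iff_subset]
    have hC : (F ∩ F').card = 1 ↔ c = 0 := by omega
    rw [hA, hB, hC, hrR]
    generalize (F \ F').card = a at *
    generalize (F' \ F).card = b at *
    have hV : (0 : ℝ) < a * b + a * (c + 1) + b * (c + 1) + (c + 1) := by positivity
    refine ⟨?_, fun h2 => ?_, ?_⟩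
    · rw [le_add_iff_nonneg_right]
      positivity
    · have hpos : (0 : ℝ) < a + b + c := by
        have : 0 < a + b + c := by omega
        exact_mod_cast this
      have h9 := nine_mul_mul_lt (Nat.cast_nonneg a) (Nat.cast_nonneg b) (Nat.cast_nonneg c) hpos
      have : (a * b * c / (a * b + a * (c + 1) + b * (c + 1) + (c + 1)) : ℝ) <
          (a + b + c) / 9 := by
        rw [div_lt_div_iff₀ hV (by norm_num)]
        linarith
      linarith
    · rw [add_eq_left, div_eq_zero_iff, or_iff_left hV.ne']
      simp only [mul_eq_zero, Nat.cast_eq_zero, or_assoc]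
  · intro ε hε
    obtain ⟨N, hN⟩ := exists_nat_gt (2 / ε)
    -- This threshold forces `n = (r - 1) / 3 > N`, hence `2 / n < ε`.
    refine ⟨3 * (N + 1) + 1, fun r hr => ?_⟩
    obtain ⟨n, s, hs, rfl⟩ : ∃ n s, s ≤ 2 ∧ r = 3 * n + s + 1 :=
      ⟨(r - 1) / 3, (r - 1) % 3, by omega, by omega⟩
    have hn : N + 1 ≤ n := by omega
    obtain ⟨A, -, hA⟩ := Finset.exists_subset_card_eq
      (s := (Finset.univ : Finset (Fin (3 * n + s + 1)))) (n := n)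
      (by rw [Finset.card_univ, Fintype.card_fin]; omega)
    obtain ⟨B, hBA, hB⟩ := Finset.exists_subset_card_eq (s := Aᶜ) (n := n)
      (by rw [Finset.card_compl, Fintype.card_fin]; omega)
    have hAB : ∀ i ∈ B, i ∉ A := fun i hi => Finset.mem_compl.1 (hBA hi)
    -- As `A` and `B` are disjoint, complements give `F \ F' = A` and `F' \ F = B`, and everything
    -- else lies in `F ∩ F'`.
    obtain ⟨F, hF⟩ : ∃ F, F = Bᶜ := ⟨_, rfl⟩
    obtain ⟨F', hF'⟩ : ∃ F', F' = Aᶜ := ⟨_, rfl⟩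
    have ha : (F \ F').card = n := by
      refine (congrArg Finset.card ?_).trans hA
      ext i
      simp only [hF, hF', Finset.mem_sdiff, Finset.mem_compl]
      grind
    have hb : (F' \ F).card = n := by
      refine (congrArg Finset.card ?_).trans hB
      ext i
      simp only [hF, hF', Finset.mem_sdiff, Finset.mem_compl]
      grind
    have hU : F ∪ F' = Finset.univ := by
      ext i
      simp only [hF, hF', Finset.mem_union, Finset.mem_compl, Finset.mem_univ, iff_true]
      grind
    have hc : (F ∩ F').card = (n + s) + 1 := by
      have h1 := Finset.card_sdiff_add_card_inter F F'
      have h2 := Finset.card_sdiff_add_card_inter F' F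
      have h3 := Finset.card_union_add_card_inter F F'
      rw [hU, Finset.card_univ, Fintype.card_fin] at h3
      rw [Finset.inter_comm F' F] at h2
      omega
    have hne : (F ∩ F').Nonempty := Finset.card_pos.1 (by omega)
    refine ⟨F, F', (setDim_add_eq_sub_one_iff (by omega)).2 ⟨hne, hU⟩, ?_⟩
    rw [averageDegree_eq hne ha hb hc]
    have hr1 : ((3 * n + s + 1 : ℕ) : ℝ) - 1 = n + n + (n + s : ℕ) := by
      push_cast
      ring
    rw [hr1]
    refine (average_ratio_close (by omega) hs).trans_lt ?_
    have hNn : (N : ℝ) < n := by exact_mod_cast hn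
    have hn0 : (0 : ℝ) < n := (Nat.cast_nonneg N).trans_lt hNn
    rw [div_lt_iff₀ hε] at hN
    rw [div_lt_iff₀ hn0]
    nlinarith
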